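/- Let $I=[0,1]$ with Lebesgue measure $m$. Let $\mathcal T$ be the class of maps $\tau:I\to I$ for which there is a countably infinite family of non-empty, pairwise disjoint open intervals $I_i=(a_i,b_i)\subset I$, $i\ge 1$, with $m\bigl(I\setminus\bigcup_i I_i\bigr)=0$, such that (1) for every $i$, $\tau_i=\tau|_{I_i}$ is (strictly) increasing, convex and differentiable, with $\lim_{x\to a_i^+}\tau_i(x)=0$; the value $\tau_i'(a_i)$ is defined as $\lim_{x\to a_i^+}\tau_i'(x)$; (2) $\tau_i'(a_i)>0$ for every $i$, and $\sum_{i\ge 1} 1/\tau_i'(a_i)<\infty$; (3) if $0$ is not a limit point of the set of partition points $\{a_i,b_i: i\ge1\}$ (so that $a_{i}=0$ for some $i$), then $\tau_i'(0)>1$ for the branch with $a_i=0$. For $n\ge 1$, let $\mathcal P^{(n)}$ be the family of the sets $J_w=\{x\in I:\tau^k(x)\in I_{w_k},\ 0\le k<n\}$, indexed by words $w=(w_0,\dots,w_{n-1})$ (some $J_w$ may be empty); $\tau^n$ is injective on each $J_w$. The Frobenius–Perron operator of $\tau^n$ is $$P_{\tau^n}f(x)=\sum_{w}\frac{f\bigl((\tau^n|_{J_w})^{-1}(x)\bigr)}{(\tau^n)'\bigl((\tau^n|_{J_w})^{-1}(x)\bigr)}\,\chi_{\tau^n(J_w)}(x),$$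 which is defined for almost every $x\in I$ when $f\in L^1(I,m)$. For real- or complex-valued $f\in L^1(I,m)$ let $\mathrm{var}_I f$ be the infimum of the total variations on $I$ of all functions equal to $f$ almost everywhere, $\|f\|_{BV}=\|f\|_1+\mathrm{var}_I f$, and $BV_I=\{f\in L^1(I,m):\|f\|_{BV}<\infty\}$. Proposition. For every $\tau\in\mathcal T$ there are an integer $n\ge 1$ and a constant $C>0$ such that for all $f\in BV_I$ one has $P_{\tau^n}f\in BV_I$ and $$\|P_{\tau^n} f\|_{BV}\le \tfrac12\|f\|_{BV}+C\|f\|_1 .$$ -/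

import Mathlib

open Set Filter Topology MeasureTheory
open scoped ENNReal

noncomputable section

/-- The unit interval `I = [0,1]`. -/
abbrev unitI : Set ℝ := Icc (0 : ℝ) 1

/-- Lebesgue measure on `I = [0,1]`. -/
abbrev lebI : Measure ℝ := volume.restrict unitI

/-- `IsPiecewiseConvex τ a b`: the map `τ : I → I` belongs to the class of piecewise convex maps
with countably many branches, with partition `I_i = (a i, b i)`. Only the values of `τ` on `I`
matter, and its values on the null set `I \ ⋃ I_i` are unrestricted. -/
structure IsPiecewiseConvex (τ : ℝ → ℝ) (a b : ℕ → ℝ) : Prop where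
  mapsTo : MapsTo τ unitI unitI
  lt : ∀ i, a i < b i
  subset : ∀ i, Ioo (a i) (b i) ⊆ unitI
  disjoint : Pairwise fun i j => Disjoint (Ioo (a i) (b i)) (Ioo (a j) (b j))
  null : volume (unitI \ ⋃ i, Ioo (a i) (b i)) = 0
  increasing : ∀ i, StrictMonoOn τ (Ioo (a i) (b i))
  convex : ∀ i, ConvexOn ℝ (Ioo (a i) (b i)) τ
  differentiable : ∀ i, DifferentiableOn ℝ τ (Ioo (a i) (b i))
  tendsto_zero : ∀ i, Tendsto τ (𝓝[>] (a i)) (𝓝 0)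
  /-- `d i` is the value of the derivative of the `i`-th branch at `a i`, defined by right
  continuity. Finiteness of `∑ 1 / d i` includes that no `d i` vanishes. If `0` is not a limit
  point of the partition points, the derivative at `0` (the left endpoint of a branch) exceeds
  one. -/
  slopes : ∃ d : ℕ → ℝ,
    (∀ i, Tendsto (deriv τ) (𝓝[>] (a i)) (𝓝 (d i))) ∧
    (∀ i, 0 < d i) ∧
    Summable (fun i => 1 / d i) ∧
    (¬ AccPt (0 : ℝ) (𝓟 (range a ∪ range b)) → ∃ i, a i = 0 ∧ 1 < d i)

/-- The cells of the partition of `τ^n`, that is, of the join of the pull-backs of the partition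
`(a i, b i)` under `τ^0, …, τ^(n-1)`: the points with itinerary `w` (possibly none). -/
def cell (τ : ℝ → ℝ) (a b : ℕ → ℝ) (n : ℕ) (w : Fin n → ℕ) : Set ℝ :=
  {x | x ∈ unitI ∧ ∀ k : Fin n, τ^[(k : ℕ)] x ∈ Ioo (a (w k)) (b (w k))}

/-- The Frobenius–Perron operator of a map `σ` with increasing branches `σ_i = σ|_{J i}`:
`P_σ f (x) = ∑ i, f (σ_i⁻¹ x) / σ' (σ_i⁻¹ x) * χ_{σ (J i)} (x)`. -/
def frobeniusPerron {𝕜 : Type*} [RCLike 𝕜] {ι : Type*} (σ : ℝ → ℝ) (J : ι → Set ℝ)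
    (f : ℝ → 𝕜) (x : ℝ) : 𝕜 :=
  ∑' i, (σ '' J i).indicator
    (fun z => f (Function.invFunOn σ (J i) z) /
      ((deriv σ (Function.invFunOn σ (J i) z) : ℝ) : 𝕜)) x

/-- The variation `var_I f` of (the `L¹` class of) `f`: the least variation on `I` among all
functions that agree with `f` almost everywhere on `I`. -/
def varI {𝕜 : Type*} [RCLike 𝕜] (f : ℝ → 𝕜) : ℝ≥0∞ :=
  ⨅ g : {g : ℝ → 𝕜 // g =ᵐ[lebI] f}, eVariationOn (g : ℝ → 𝕜) unitI

/-- The norm `‖f‖_BV = ‖f‖₁ + var_I f`, with values in `[0,∞]`. -/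
def bvNorm {𝕜 : Type*} [RCLike 𝕜] (f : ℝ → 𝕜) : ℝ≥0∞ :=
  eLpNorm f 1 lebI + varI f

/-- `f` (more precisely, its class) belongs to `BV_I = {f ∈ L¹ : ‖f‖_BV < ∞}`. -/
def MemBV {𝕜 : Type*} [RCLike 𝕜] (f : ℝ → 𝕜) : Prop :=
  MemLp f 1 lebI ∧ bvNorm f < ∞

end

/-- The variation on the union of two consecutive sets exceeds the sum of the variations by at most
the jump between them. -/
theorem eVariationOn_union_le {α E : Type*} [LinearOrder α] [PseudoEMetricSpace E] (f : α → E)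
    {s t : Set α} (hst : ∀ x ∈ s, ∀ y ∈ t, x ≤ y) {D : ℝ≥0∞}
    (hD : ∀ x ∈ s, ∀ y ∈ t, edist (f y) (f x) ≤ D) :
    eVariationOn f (s ∪ t) ≤ eVariationOn f s + eVariationOn f t + D := by
  classical
  refine iSup_le ?_
  rintro ⟨n, u, hu, us⟩
  dsimp only
  by_cases hs : ∀ i, i ≤ n → u i ∈ s
  · have := eVariationOn.sum_le_of_monotoneOn_Iic (f := f) (s := s) (n := n) (hu.monotoneOn _) hs
    exact this.trans (by rw [add_assoc]; exact le_self_add)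
  push Not at hs
  obtain ⟨k, ⟨hkn, hks⟩, hmin⟩ : ∃ k, (k ≤ n ∧ u k ∉ s) ∧ ∀ i < k, ¬ (i ≤ n ∧ u i ∉ s) :=
    ⟨Nat.find hs, Nat.find_spec hs, fun i hi => Nat.find_min hs hi⟩
  have hlow : ∀ i < k, u i ∈ s := fun i hi => by
    by_contra h
    exact hmin i hi ⟨hi.le.trans hkn, h⟩
  have hkt : u k ∈ t := (us k).resolve_left hks
  have hmem : ∀ i, k ≤ i → u i ∈ t := fun i hi => by
    rcases us i with h | h
    · have : u i = u k := le_antisymm (hst _ h _ hkt) (hu hi)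
      rwa [this]
    · exact h
  have hup : ∑ i ∈ Finset.Ico k n, edist (f (u (i + 1))) (f (u i)) ≤ eVariationOn f t :=
    eVariationOn.sum_le_of_monotoneOn_Icc (hu.monotoneOn _) fun i hi => hmem i hi.1
  rw [← Finset.sum_range_add_sum_Ico _ hkn]
  rcases k with _ | k
  · simpa using hup.trans (le_add_left le_rfl |>.trans le_self_add)
  · rw [Finset.sum_range_succ]
    have h1 : ∑ i ∈ Finset.range k, edist (f (u (i + 1))) (f (u i)) ≤ eVariationOn f s :=
      eVariationOn.sum_le_of_monotoneOn_Iic (hu.monotoneOn _) fun i hi => hlow i (by omega)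
    have h2 : edist (f (u (k + 1))) (f (u k)) ≤ D := hD _ (hlow k (by omega)) _ hkt
    calc _ ≤ eVariationOn f s + D + eVariationOn f t := by gcongr
      _ = _ := by ring

/-- The variation of a function vanishing outside an order-connected set. -/
theorem eVariationOn_le_of_eq_zero_off {α E : Type*} [LinearOrder α] [SeminormedAddCommGroup E]
    (f : α → E) {s t : Set α} (hs : s.OrdConnected) (hst : s ⊆ t) (h0 : ∀ x ∉ s, f x = 0)
    {M : ℝ≥0∞} (hM : ∀ x ∈ s, ‖f x‖ₑ ≤ M) :
    eVariationOn f t ≤ eVariationOn f s + 2 * M := by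
  rcases s.eq_empty_or_nonempty with rfl | ⟨z, hz⟩
  · rw [eVariationOn.constant_on]
    · exact zero_le
    · rintro _ ⟨x, -, rfl⟩ _ ⟨y, -, rfl⟩
      rw [h0 x (by simp), h0 y (by simp)]
  set l : Set α := {x | x ∉ s ∧ x ≤ z}
  set r : Set α := {x | x ∉ s ∧ z ≤ x}
  have hl : ∀ x ∈ l, ∀ y ∈ s, x ≤ y := fun x hx y hy => by
    by_contra h
    exact hx.1 (hs.out hy hz ⟨(not_le.1 h).le, hx.2⟩)
  have hr : ∀ y ∈ s, ∀ x ∈ r, y ≤ x := fun y hy x hx => by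
    by_contra h
    exact hx.1 (hs.out hz hy ⟨hx.2, (not_le.1 h).le⟩)
  have hl0 : eVariationOn f l = 0 := eVariationOn.constant_on <| by
    rintro _ ⟨x, hx, rfl⟩ _ ⟨y, hy, rfl⟩
    rw [h0 x hx.1, h0 y hy.1]
  have hr0 : eVariationOn f r = 0 := eVariationOn.constant_on <| by
    rintro _ ⟨x, hx, rfl⟩ _ ⟨y, hy, rfl⟩
    rw [h0 x hx.1, h0 y hy.1]
  have hsub : t ⊆ (l ∪ s) ∪ r := fun x _ => by
    by_cases hx : x ∈ s
    · exact Or.inl (Or.inr hx)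
    · rcases le_total x z with h | h
      · exact Or.inl (Or.inl ⟨hx, h⟩)
      · exact Or.inr ⟨hx, h⟩
  have h1 : eVariationOn f (l ∪ s) ≤ eVariationOn f l + eVariationOn f s + M :=
    eVariationOn_union_le f hl fun x hx y hy => by
      rw [h0 x hx.1, edist_zero_right]; exact hM y hy
  have h2 : eVariationOn f ((l ∪ s) ∪ r) ≤ eVariationOn f (l ∪ s) + eVariationOn f r + M := by
    refine eVariationOn_union_le f ?_ fun x hx y hy => ?_
    · rintro x (hx | hx) y hy
      · exact hx.2.trans hy.2
      · exact hr x hx y hy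
    · rw [h0 y hy.1, edist_zero_left]
      rcases hx with hx | hx
      · rw [h0 x hx.1]; simp
      · exact hM x hx
  calc eVariationOn f t ≤ eVariationOn f ((l ∪ s) ∪ r) := eVariationOn.mono f hsub
    _ ≤ (eVariationOn f l + eVariationOn f s + M) + eVariationOn f r + M := h2.trans (by gcongr)
    _ = _ := by rw [hl0, hr0]; ring

theorem AntitoneOn.eVariationOn_le_of_mem_Icc {α : Type*} [LinearOrder α] {φ : α → ℝ} {s : Set α}
    (hφ : AntitoneOn φ s) {c : ℝ} (h : ∀ x ∈ s, φ x ∈ Icc 0 c) :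
    eVariationOn φ s ≤ ENNReal.ofReal c := by
  refine iSup_le ?_
  rintro ⟨n, u, hu, us⟩
  dsimp only
  have h1 : ∀ i, edist (φ (u (i + 1))) (φ (u i)) = ENNReal.ofReal (φ (u i) - φ (u (i + 1))) :=
    fun i => by
      rw [edist_comm, edist_dist, Real.dist_eq, abs_of_nonneg]
      exact sub_nonneg.2 (hφ (us _) (us _) (hu i.le_succ))
  simp_rw [h1]
  rw [← ENNReal.ofReal_sum_of_nonneg, Finset.sum_range_sub']
  · exact ENNReal.ofReal_le_ofReal (by linarith [(h _ (us 0)).2, (h _ (us n)).1])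
  · exact fun i _ => sub_nonneg.2 (hφ (us _) (us _) (hu i.le_succ))

/-- Countable subadditivity of the variation. -/
theorem eVariationOn_tsum_le {α ι E : Type*} [LinearOrder α] [NormedAddCommGroup E]
    (h : ι → α → E) {s : Set α} (hsum : ∀ x ∈ s, Summable fun i => h i x) :
    eVariationOn (fun x => ∑' i, h i x) s ≤ ∑' i, eVariationOn (h i) s := by
  refine iSup_le ?_
  rintro ⟨n, u, hu, us⟩
  dsimp only
  calc _ ≤ ∑ k ∈ Finset.range n, ∑' i, edist (h i (u (k + 1))) (h i (u k)) :=
        Finset.sum_le_sum fun k _ => by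
          simp_rw [edist_eq_enorm_sub]
          rw [← (hsum _ (us _)).tsum_sub (hsum _ (us _))]
          exact enorm_tsum_le_tsum_enorm
    _ = ∑' i, ∑ k ∈ Finset.range n, edist (h i (u (k + 1))) (h i (u k)) :=
        (Summable.tsum_finsetSum fun _ _ => ENNReal.summable).symm
    _ ≤ _ := ENNReal.tsum_le_tsum fun i => eVariationOn.sum_le hu us

/-- Disjoint order-connected sets with given points are ordered as these points are. -/
theorem le_of_disjoint_ordConnected {α : Type*} [LinearOrder α] {s t : Set α}
    (hs : s.OrdConnected) (ht : t.OrdConnected) (hst : Disjoint s t) {p q : α} (hp : p ∈ s)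
    (hq : q ∈ t) (hpq : p ≤ q) {x y : α} (hx : x ∈ s) (hy : y ∈ t) : x ≤ y := by
  by_contra hlt
  rw [not_le] at hlt
  rcases le_total x q with h | h
  · exact disjoint_left.1 hst hx (ht.out hy hq ⟨hlt.le, h⟩)
  · exact disjoint_left.1 hst (hs.out hp hx ⟨hpq, h⟩) hq

/-- The variations on disjoint intervals add up to at most the total variation. -/
theorem sum_eVariationOn_le {α ι E : Type*} [LinearOrder α] [PseudoEMetricSpace E] (f : α → E)
    {J : ι → Set α} (hJ : ∀ i, (J i).OrdConnected) (hd : Pairwise fun i j => Disjoint (J i) (J j))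
    {t : Set α} (ht : ∀ i, J i ⊆ t) (F : Finset ι) :
    ∑ i ∈ F, eVariationOn f (J i) ≤ eVariationOn f t := by
  classical
  by_cases hne : t.Nonempty
  swap
  · have : ∀ i, J i = ∅ := fun i => subset_eq_empty (ht i) (not_nonempty_iff_eq_empty.1 hne)
    simp [this]
  obtain ⟨z, -⟩ := hne
  have hp : ∃ p : ι → α, ∀ i, (J i).Nonempty → p i ∈ J i := by
    refine ⟨fun i => if h : (J i).Nonempty then h.some else z, fun i h => ?_⟩
    simp only [dif_pos h]
    exact h.some_mem
  obtain ⟨p, hp⟩ := hp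
  suffices h : ∑ i ∈ F, eVariationOn f (J i) ≤ eVariationOn f (⋃ i ∈ F, J i) from
    h.trans (eVariationOn.mono f (iUnion₂_subset fun i _ => ht i))
  induction F using Finset.induction_on_max_value p with
  | empty => simp
  | insert i F hi hmax ih =>
    rw [Finset.sum_insert hi, Finset.set_biUnion_insert, union_comm, add_comm]
    refine (add_le_add_left ih _).trans (eVariationOn.add_le_union f fun x hx y hy => ?_)
    obtain ⟨j, hj, hxj⟩ := mem_iUnion₂.1 hx
    exact le_of_disjoint_ordConnected (hJ j) (hJ i) (hd fun h => hi (h ▸ hj)) (hp j ⟨x, hxj⟩)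
      (hp i ⟨y, hy⟩) (hmax j hj) hxj hy

/-- A function of bounded variation is bounded by its variation plus its mean absolute value. -/
theorem enorm_le_eVariationOn_add {E : Type*} [NormedAddCommGroup E] (f : ℝ → E) {s t : Set ℝ}
    (hs : MeasurableSet s) (hst : s ⊆ t) (h0 : volume s ≠ 0) (h1 : volume s ≠ ∞) {x : ℝ}
    (hx : x ∈ s) :
    ‖f x‖ₑ ≤ eVariationOn f s + (volume s)⁻¹ * eLpNorm f 1 (volume.restrict t) := by
  rw [eLpNorm_one_eq_lintegral_enorm]
  have h : ‖f x‖ₑ * volume s ≤ eVariationOn f s * volume s + ∫⁻ y in t, ‖f y‖ₑ := by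
    calc ‖f x‖ₑ * volume s = ∫⁻ _ in s, ‖f x‖ₑ := by rw [setLIntegral_const]
      _ ≤ ∫⁻ y in s, (eVariationOn f s + ‖f y‖ₑ) := by
          refine setLIntegral_mono' hs fun y hy => ?_
          calc ‖f x‖ₑ = ‖(f x - f y) + f y‖ₑ := by rw [sub_add_cancel]
            _ ≤ ‖f x - f y‖ₑ + ‖f y‖ₑ := enorm_add_le _ _
            _ ≤ _ := by
                rw [← edist_eq_enorm_sub]
                gcongr
                exact eVariationOn.edist_le f hx hy
      _ = eVariationOn f s * volume s + ∫⁻ y in s, ‖f y‖ₑ := by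
          rw [lintegral_add_left measurable_const, setLIntegral_const]
      _ ≤ _ := by
          gcongr
  calc ‖f x‖ₑ = ‖f x‖ₑ * volume s * (volume s)⁻¹ := by
        rw [mul_assoc, ENNReal.mul_inv_cancel h0 h1, mul_one]
    _ ≤ (eVariationOn f s * volume s + ∫⁻ y in t, ‖f y‖ₑ) * (volume s)⁻¹ := by gcongr
    _ = _ := by
        rw [add_mul, mul_assoc, ENNReal.mul_inv_cancel h0 h1, mul_one, mul_comm (volume s)⁻¹]

theorem BoundedVariationOn.aemeasurable_restrict {f : ℝ → ℝ} {s : Set ℝ}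
    (hf : BoundedVariationOn f s) (hs : MeasurableSet s) : AEMeasurable f (volume.restrict s) := by
  obtain ⟨p, q, hp, hq, rfl⟩ := hf.locallyBoundedVariationOn.exists_monotoneOn_sub_monotoneOn
  exact (aemeasurable_restrict_of_monotoneOn hs hp).sub (aemeasurable_restrict_of_monotoneOn hs hq)

theorem BoundedVariationOn.aestronglyMeasurable_restrict {𝕜 : Type*} [RCLike 𝕜] {f : ℝ → 𝕜}
    {s : Set ℝ} (hf : BoundedVariationOn f s) (hs : MeasurableSet s) :
    AEStronglyMeasurable f (volume.restrict s) := by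
  have hre : BoundedVariationOn (fun x => RCLike.re (f x)) s :=
    (LipschitzWith.of_le_add_mul 1 fun x y => by
      have := (abs_le.1 (RCLike.abs_re_le_norm (x - y))).2
      rw [map_sub] at this
      rw [dist_eq_norm, NNReal.coe_one, one_mul]; linarith).comp_boundedVariationOn hf
  have him : BoundedVariationOn (fun x => RCLike.im (f x)) s :=
    (LipschitzWith.of_le_add_mul 1 fun x y => by
      have := (abs_le.1 (RCLike.abs_im_le_norm (x - y))).2
      rw [map_sub] at this
      rw [dist_eq_norm, NNReal.coe_one, one_mul]; linarith).comp_boundedVariationOn hf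
  exact (aemeasurable_of_re_im (hre.aemeasurable_restrict hs)
    (him.aemeasurable_restrict hs)).aestronglyMeasurable

theorem exists_pow_bounds_of_two_regimes {r q c e : ℝ} (hr : 1 < r) (hq : 1 < q) (hc : 0 < c)
    (he : 0 < e) (he1 : e ≤ 1) (K : ℝ) :
    ∃ n : ℕ, 0 < n ∧ ∀ j g : ℕ, j + g = n → ∀ L : ℝ, c * q ^ j ≤ L → e ^ j * r ^ g ≤ L → K ≤ L := by
  obtain ⟨J, hJ⟩ := pow_unbounded_of_one_lt (K / c) hq
  obtain ⟨G, hG⟩ := pow_unbounded_of_one_lt (K / e ^ J) hr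
  refine ⟨J + G + 1, by omega, fun j g hjg L h1 h2 => ?_⟩
  rcases le_total J j with h | h
  · refine le_trans ?_ h1
    rw [div_lt_iff₀' hc] at hJ
    exact hJ.le.trans (by gcongr; exact hq.le)
  · refine le_trans ?_ h2
    rw [div_lt_iff₀' (by positivity)] at hG
    have h3 : e ^ J ≤ e ^ j := pow_le_pow_of_le_one he.le he1 h
    have h4 : r ^ G ≤ r ^ g := pow_le_pow_right₀ hr.le (by omega)
    exact hG.le.trans (mul_le_mul h3 h4 (by positivity) (by positivity))

/-- Growth of the product of the slopes `t k` along an orbit `x k`. At good times the slope is at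
least `r`; at bad times the map expands in the logarithmic coordinate by `q`. -/
theorem exists_bounds_prod_slopes {x t : ℕ → ℝ} {bad : ℕ → Prop} {r q c e δ : ℝ} (hr : 1 ≤ r)
    (hq : 1 ≤ q) (he : 0 < e) (hc : 0 < c) (hc1 : c ≤ 1) (hcq : c * q ≤ e * δ) (n : ℕ)
    (hx0 : x 0 ≤ 1) (hx : ∀ k < n, 0 < x k)
    (hbad : ∀ k < n, bad k → δ ≤ x k ∧ e ≤ t k ∧ q * x (k + 1) ≤ t k * x k)
    (hgood : ∀ k < n, ¬ bad k → r ≤ t k ∧ x (k + 1) ≤ t k * x k) :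
    ∃ j g : ℕ, j + g = n ∧ x n * q ^ j ≤ ∏ k ∈ Finset.range n, t k ∧
      c * q ^ j ≤ ∏ k ∈ Finset.range n, t k ∧ e ^ j * r ^ g ≤ ∏ k ∈ Finset.range n, t k := by
  induction n with
  | zero => exact ⟨0, 0, rfl, by simpa using hx0, by simpa using hc1, by simp⟩
  | succ n ih =>
    obtain ⟨j, g, hn, h1, h2, h3⟩ := ih (fun k hk => hx k (by omega))
      (fun k hk => hbad k (by omega)) (fun k hk => hgood k (by omega))
    rw [Finset.prod_range_succ]
    set L := ∏ k ∈ Finset.range n, t k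
    have hL : 0 < L := lt_of_lt_of_le (by positivity) h2
    have hxn := hx n (by omega)
    by_cases hb : bad n
    · obtain ⟨b1, b2, b3⟩ := hbad n (by omega) hb
      have ht : 0 < t n := he.trans_le b2
      refine ⟨j + 1, g, by omega, ?_, ?_, ?_⟩
      · calc x (n + 1) * q ^ (j + 1) = (q * x (n + 1)) * q ^ j := by ring
          _ ≤ (t n * x n) * q ^ j := by gcongr
          _ = (x n * q ^ j) * t n := by ring
          _ ≤ L * t n := by gcongr
      · calc c * q ^ (j + 1) = (c * q) * q ^ j := by ring
          _ ≤ (e * δ) * q ^ j := by gcongr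
          _ ≤ (e * x n) * q ^ j := by gcongr
          _ = (x n * q ^ j) * e := by ring
          _ ≤ L * t n := by gcongr
      · calc e ^ (j + 1) * r ^ g = (e ^ j * r ^ g) * e := by ring
          _ ≤ L * t n := by gcongr
    · obtain ⟨b1, b2⟩ := hgood n (by omega) hb
      have ht : 1 ≤ t n := hr.trans b1
      refine ⟨j, g + 1, by omega, ?_, ?_, ?_⟩
      · calc x (n + 1) * q ^ j ≤ (t n * x n) * q ^ j := by gcongr
          _ = (x n * q ^ j) * t n := by ring
          _ ≤ L * t n := by gcongr
      · exact h2.trans (le_mul_of_one_le_right hL.le ht)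
      · calc e ^ j * r ^ (g + 1) = (e ^ j * r ^ g) * r := by ring
          _ ≤ L * t n := by gcongr

namespace IsPiecewiseConvex

variable {τ : ℝ → ℝ} {a b : ℕ → ℝ}

theorem endpoints (h : IsPiecewiseConvex τ a b) (i : ℕ) : 0 ≤ a i ∧ b i ≤ 1 := by
  have h1 : Icc (a i) (b i) ⊆ Icc (0 : ℝ) 1 := by
    rw [← closure_Ioo (h.lt i).ne]
    exact closure_minimal (h.subset i) isClosed_Icc
  exact ⟨(h1 (left_mem_Icc.2 (h.lt i).le)).1, (h1 (right_mem_Icc.2 (h.lt i).le)).2⟩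

theorem differentiableAt (h : IsPiecewiseConvex τ a b) {i : ℕ} {y : ℝ} (hy : y ∈ Ioo (a i) (b i)) :
    DifferentiableAt ℝ τ y :=
  (h.differentiable i).differentiableAt (isOpen_Ioo.mem_nhds hy)

theorem monotoneOn_deriv (h : IsPiecewiseConvex τ a b) (i : ℕ) :
    MonotoneOn (deriv τ) (Ioo (a i) (b i)) :=
  (h.convex i).monotoneOn_deriv fun _ hx => h.differentiableAt hx

theorem le_deriv (h : IsPiecewiseConvex τ a b) {i : ℕ} {d y : ℝ}
    (hd : Tendsto (deriv τ) (𝓝[>] (a i)) (𝓝 d)) (hy : y ∈ Ioo (a i) (b i)) : d ≤ deriv τ y := by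
  refine le_of_tendsto hd ?_
  filter_upwards [Ioo_mem_nhdsGT hy.1] with x hx
  exact h.monotoneOn_deriv i ⟨hx.1, hx.2.trans hy.2⟩ hy hx.2.le

theorem apply_le_deriv_mul (h : IsPiecewiseConvex τ a b) {i : ℕ} {y : ℝ}
    (hy : y ∈ Ioo (a i) (b i)) : τ y ≤ deriv τ y * (y - a i) := by
  have h1 : Tendsto (fun x => τ y - τ x) (𝓝[>] (a i)) (𝓝 (τ y - 0)) :=
    tendsto_const_nhds.sub (h.tendsto_zero i)
  have h2 : Tendsto (fun x => deriv τ y * (y - x)) (𝓝[>] (a i)) (𝓝 (deriv τ y * (y - a i))) :=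
    (Continuous.tendsto (by fun_prop) (a i)).mono_left nhdsWithin_le_nhds
  rw [sub_zero] at h1
  refine le_of_tendsto_of_tendsto h1 h2 ?_
  filter_upwards [Ioo_mem_nhdsGT hy.1] with x hx
  have := (h.convex i).slope_le_deriv ⟨hx.1, hx.2.trans hy.2⟩ hy hx.2 (h.differentiableAt hy)
  rw [slope_def_field, div_le_iff₀ (by linarith [hx.2])] at this
  exact this

/-- A branch that starts at `0` is expanding. -/
theorem one_lt_of_left_eq_zero (h : IsPiecewiseConvex τ a b) {d : ℕ → ℝ}
    (hd : ¬ AccPt (0 : ℝ) (𝓟 (range a ∪ range b)) → ∃ i, a i = 0 ∧ 1 < d i) {i : ℕ}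
    (hi : a i = 0) : 1 < d i := by
  have hbi : 0 < b i := hi ▸ h.lt i
  have key : ∀ j, j ≠ i → b i ≤ a j := fun j hj => by
    by_contra hlt
    rw [not_le] at hlt
    have h1 := h.endpoints j
    have h2 := h.lt j
    have h3 : a j < min (b i) (b j) := lt_min hlt h2
    obtain ⟨x, hx1, hx2⟩ := exists_between h3
    exact disjoint_left.1 (h.disjoint hj) (show x ∈ Ioo (a j) (b j) from
      ⟨hx1, hx2.trans_le (min_le_right _ _)⟩)
      ⟨by rw [hi]; exact h1.1.trans_lt hx1, hx2.trans_le (min_le_left _ _)⟩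
  obtain ⟨j, hj, hdj⟩ := hd <| by
    rw [accPt_iff_nhds]
    intro hacc
    obtain ⟨y, ⟨hy, hyr⟩, hy0⟩ := hacc (Iio (b i)) (Iio_mem_nhds hbi)
    rcases hyr with ⟨j, rfl⟩ | ⟨j, rfl⟩
    · by_cases hj : j = i
      · exact hy0 (hj ▸ hi)
      · exact absurd hy (not_lt.2 (key j hj))
    · by_cases hj : j = i
      · subst hj
        exact lt_irrefl _ (mem_Iio.1 hy)
      · exact absurd hy (not_lt.2 ((key j hj).trans (h.lt j).le))
  by_cases hji : j = i
  · exact hji ▸ hdj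
  · have := key j hji
    linarith

/-- The iterates of `τ` are uniformly expanding, by an arbitrarily large factor. -/
theorem exists_expanding (h : IsPiecewiseConvex τ a b) (K : ℝ) :
    ∃ n : ℕ, 0 < n ∧ ∀ x, (∀ k < n, ∃ i, τ^[k] x ∈ Ioo (a i) (b i)) →
      K ≤ ∏ k ∈ Finset.range n, deriv τ (τ^[k] x) := by
  obtain ⟨d, hd, hd0, hds, hacc⟩ := h.slopes
  have hzero : ∀ i, a i = 0 → 1 < d i := fun i hi => h.one_lt_of_left_eq_zero hacc hi
  have hlim : ∀ R : ℝ, {i | d i < R}.Finite := fun R => by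
    have h1 : ∀ᶠ i in cofinite, 1 / d i < 1 / (max R 1) :=
      (tendsto_order.1 hds.tendsto_cofinite_zero).2 _ (by positivity)
    refine h1.subset fun i hi => ?_
    rw [mem_ofPred_eq] at hi
    intro hlt
    exact absurd (lt_of_one_div_lt_one_div (hd0 i) hlt)
      (not_lt.2 (hi.le.trans (le_max_left _ _)))
  obtain ⟨r, hr, hr0⟩ : ∃ r : ℝ, 1 < r ∧ ∀ i, d i < r → 0 < a i := by
    have hfin : {i | d i < 2 ∧ a i = 0}.Finite := (hlim 2).subset fun i hi => hi.1
    obtain ⟨r, hr1, hr⟩ : ∃ r : ℝ, 1 < r ∧ ∀ i ∈ hfin.toFinset, r < d i := by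
      have h1 : ∀ᶠ r in 𝓝[>] (1 : ℝ), ∀ i ∈ hfin.toFinset, r < d i :=
        (Finset.eventually_all _).2 fun i hi =>
          (nhdsWithin_le_nhds (Iio_mem_nhds (hzero i ((hfin.mem_toFinset.1 hi).2))))
      obtain ⟨r, h2, h3⟩ := (h1.and self_mem_nhdsWithin).exists
      exact ⟨r, h3, h2⟩
    refine ⟨min r 2, lt_min hr1 one_lt_two, fun i hi => ?_⟩
    refine lt_of_le_of_ne (h.endpoints i).1 fun h0 => ?_
    have h2 := hr i (hfin.mem_toFinset.2 ⟨hi.trans_le (min_le_right _ _), h0.symm⟩)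
    exact absurd (hi.trans_le (min_le_left _ _)) (not_lt.2 h2.le)
  have hB := hlim r
  obtain ⟨δ, hδ, hδ1, hδa, hδd⟩ : ∃ δ : ℝ, 0 < δ ∧ δ < 1 ∧ (∀ i ∈ hB.toFinset, δ < a i) ∧
      ∀ i ∈ hB.toFinset, δ < d i := by
    have h1 : ∀ᶠ δ in 𝓝[>] (0 : ℝ), ∀ i ∈ hB.toFinset, δ < a i :=
      (Finset.eventually_all _).2 fun i hi =>
        (nhdsWithin_le_nhds (Iio_mem_nhds (hr0 i (hB.mem_toFinset.1 hi))))
    have h2 : ∀ᶠ δ in 𝓝[>] (0 : ℝ), ∀ i ∈ hB.toFinset, δ < d i :=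
      (Finset.eventually_all _).2 fun i hi => (nhdsWithin_le_nhds (Iio_mem_nhds (hd0 i)))
    obtain ⟨δ, h3, h4, h5, h6⟩ := (h1.and (h2.and ((eventually_mem_nhdsWithin (s := Ioi (0 : ℝ))).and
      (nhdsWithin_le_nhds (Iio_mem_nhds one_pos))))).exists
    exact ⟨δ, h5, h6, h3, h4⟩
  set q : ℝ := (1 - δ)⁻¹ with hqdef
  have hq : 1 < q := (one_lt_inv₀ (by linarith)).2 (by linarith)
  have hqδ : q * (1 - δ) = 1 := inv_mul_cancel₀ (by linarith)
  set c : ℝ := min 1 (δ * δ / q)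
  have hc : 0 < c := lt_min one_pos (by positivity)
  have hcq : c * q ≤ δ * δ := by
    rw [← le_div_iff₀ (by positivity)]
    exact min_le_right _ _
  obtain ⟨n, hn, H⟩ := exists_pow_bounds_of_two_regimes hr hq hc hδ hδ1.le K
  refine ⟨n, hn, fun x hx => ?_⟩
  choose! w hw using hx
  obtain ⟨j, g, hjg, -, h2, h3⟩ := exists_bounds_prod_slopes (x := fun k => τ^[k] x)
    (t := fun k => deriv τ (τ^[k] x)) (bad := fun k => d (w k) < r) hr.le hq.le hδ hc
    (min_le_left _ _) hcq n ((hw 0 hn).2.le.trans (h.endpoints _).2)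
    (fun k hk => (h.endpoints (w k)).1.trans_lt (hw k hk).1)
    (fun k hk hb => by
      have hy := hw k hk
      have hB' := hB.mem_toFinset.2 hb
      have ha := hδa _ hB'
      have hD := (hδd _ hB').le.trans (h.le_deriv (hd _) hy)
      refine ⟨(ha.trans hy.1).le, hD, ?_⟩
      simp only [Function.iterate_succ_apply']
      have h1 := h.apply_le_deriv_mul hy
      have hy1 : τ^[k] x ≤ 1 := hy.2.le.trans (h.endpoints _).2
      calc q * τ (τ^[k] x) ≤ q * (deriv τ (τ^[k] x) * (τ^[k] x - a (w k))) := by gcongr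
        _ ≤ q * (deriv τ (τ^[k] x) * ((1 - δ) * τ^[k] x)) := by
            have : 0 < deriv τ (τ^[k] x) := hδ.trans_le hD
            gcongr
            nlinarith
        _ = (q * (1 - δ)) * (deriv τ (τ^[k] x) * τ^[k] x) := by ring
        _ = _ := by rw [hqδ, one_mul])
    (fun k hk hb => by
      have hy := hw k hk
      have hD := h.le_deriv (hd _) hy
      refine ⟨(not_lt.1 hb).trans hD, ?_⟩
      simp only [Function.iterate_succ_apply']
      have h1 := h.apply_le_deriv_mul hy
      have h2 : 0 < deriv τ (τ^[k] x) := (hd0 _).trans_le hD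
      have h3 := (h.endpoints (w k)).1
      nlinarith)
  exact H j g hjg _ h2 h3

theorem hasDerivAt_iterate (h : IsPiecewiseConvex τ a b) {n : ℕ} {x : ℝ}
    (hx : ∀ k < n, ∃ i, τ^[k] x ∈ Ioo (a i) (b i)) :
    HasDerivAt τ^[n] (∏ k ∈ Finset.range n, deriv τ (τ^[k] x)) x := by
  induction n with
  | zero => simpa using hasDerivAt_id x
  | succ n ih =>
    obtain ⟨i, hi⟩ := hx n (by omega)
    rw [Function.iterate_succ', Finset.prod_range_succ, mul_comm]
    exact (h.differentiableAt hi).hasDerivAt.comp x (ih fun k hk => hx k (by omega))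

end IsPiecewiseConvex

section Cell

variable {τ : ℝ → ℝ} {a b : ℕ → ℝ} {n : ℕ} {w : Fin n → ℕ}

theorem exists_mem_of_mem_cell {x : ℝ} (hx : x ∈ cell τ a b n w) :
    ∀ k < n, ∃ i, τ^[k] x ∈ Ioo (a i) (b i) :=
  fun k hk => ⟨_, hx.2 ⟨k, hk⟩⟩

theorem pairwise_disjoint_cell (h : IsPiecewiseConvex τ a b) (n : ℕ) :
    Pairwise fun v w : Fin n → ℕ => Disjoint (cell τ a b n v) (cell τ a b n w) := by
  intro v w hvw
  obtain ⟨k, hk⟩ := Function.ne_iff.1 hvw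
  exact disjoint_left.2 fun x hx hy => disjoint_left.1 (h.disjoint hk) (hx.2 k) (hy.2 k)

theorem strictMonoOn_iterate_cell (h : IsPiecewiseConvex τ a b) {m : ℕ} (hm : m ≤ n) :
    StrictMonoOn τ^[m] (cell τ a b n w) := by
  induction m with
  | zero => exact strictMono_id.strictMonoOn _
  | succ m ih =>
    intro x hx y hy hxy
    rw [Function.iterate_succ_apply', Function.iterate_succ_apply']
    exact h.increasing _ (hx.2 ⟨m, hm⟩) (hy.2 ⟨m, hm⟩) (ih (by omega) hx hy hxy)

theorem ordConnected_cell (h : IsPiecewiseConvex τ a b) : (cell τ a b n w).OrdConnected := by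
  refine ⟨fun x hx y hy z hz => ?_⟩
  have hzI : z ∈ unitI := ⟨hx.1.1.trans hz.1, hz.2.trans hy.1.2⟩
  have key : ∀ m ≤ n, (∀ k : Fin n, (k : ℕ) < m → τ^[(k : ℕ)] z ∈ Ioo (a (w k)) (b (w k))) ∧
      τ^[m] x ≤ τ^[m] z ∧ τ^[m] z ≤ τ^[m] y := by
    intro m
    induction m with
    | zero => exact fun _ => ⟨fun k hk => absurd hk (by omega), hz.1, hz.2⟩
    | succ m ih =>
      intro hm
      obtain ⟨h1, h2, h3⟩ := ih (by omega)
      have hzm : τ^[m] z ∈ Ioo (a (w ⟨m, hm⟩)) (b (w ⟨m, hm⟩)) :=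
        ordConnected_Ioo.out (hx.2 ⟨m, hm⟩) (hy.2 ⟨m, hm⟩) ⟨h2, h3⟩
      refine ⟨fun k hk => ?_, ?_, ?_⟩
      · rcases (Nat.lt_succ_iff.1 hk).lt_or_eq with h4 | h4
        · exact h1 k h4
        · obtain rfl : k = ⟨m, hm⟩ := Fin.ext h4
          exact hzm
      · simp only [Function.iterate_succ_apply']
        exact (h.increasing _).monotoneOn (hx.2 ⟨m, hm⟩) hzm h2
      · simp only [Function.iterate_succ_apply']
        exact (h.increasing _).monotoneOn hzm (hy.2 ⟨m, hm⟩) h3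
  exact ⟨hzI, fun k => (key n le_rfl).1 k k.2⟩

theorem isOpen_cell (h : IsPiecewiseConvex τ a b) (hn : 0 < n) : IsOpen (cell τ a b n w) := by
  have key : ∀ m ≤ n, IsOpen {x | ∀ k : Fin n, (k : ℕ) < m →
      τ^[(k : ℕ)] x ∈ Ioo (a (w k)) (b (w k))} := by
    intro m
    induction m with
    | zero => simp
    | succ m ih =>
      intro hm
      have hc : ContinuousOn τ^[m] {x | ∀ k : Fin n, (k : ℕ) < m →
          τ^[(k : ℕ)] x ∈ Ioo (a (w k)) (b (w k))} := fun x hx =>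
        (h.hasDerivAt_iterate fun k hk =>
          ⟨_, hx ⟨k, by omega⟩ hk⟩).continuousAt.continuousWithinAt
      convert hc.isOpen_inter_preimage (ih (by omega)) (isOpen_Ioo (a := a (w ⟨m, hm⟩))
        (b := b (w ⟨m, hm⟩))) using 1
      ext x
      simp only [mem_ofPred_eq, mem_inter_iff, mem_preimage]
      refine ⟨fun hx => ⟨fun k hk => hx k (by omega), hx ⟨m, hm⟩ (Nat.lt_succ_self m)⟩,
        fun hx k hk => ?_⟩
      rcases (Nat.lt_succ_iff.1 hk).lt_or_eq with h4 | h4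
      · exact hx.1 k h4
      · obtain rfl : k = ⟨m, hm⟩ := Fin.ext h4
        exact hx.2
  convert key n le_rfl using 1
  ext x
  exact ⟨fun hx k _ => hx.2 k, fun hx => ⟨h.subset _ (hx ⟨0, hn⟩ hn), fun k => hx k k.2⟩⟩

theorem deriv_iterate_cell (h : IsPiecewiseConvex τ a b) {x : ℝ} (hx : x ∈ cell τ a b n w) :
    deriv τ^[n] x = ∏ k : Fin n, deriv τ (τ^[(k : ℕ)] x) := by
  rw [(h.hasDerivAt_iterate (exists_mem_of_mem_cell hx)).deriv, Finset.prod_range]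

theorem deriv_pos (h : IsPiecewiseConvex τ a b) {i : ℕ} {y : ℝ} (hy : y ∈ Ioo (a i) (b i)) :
    0 < deriv τ y := by
  obtain ⟨d, hd, hd0, -⟩ := h.slopes
  exact (hd0 i).trans_le (h.le_deriv (hd i) hy)

theorem deriv_iterate_cell_pos (h : IsPiecewiseConvex τ a b) {x : ℝ} (hx : x ∈ cell τ a b n w) :
    0 < deriv τ^[n] x := by
  rw [deriv_iterate_cell h hx]
  exact Finset.prod_pos fun k _ => deriv_pos h (hx.2 k)

theorem monotoneOn_deriv_iterate_cell (h : IsPiecewiseConvex τ a b) :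
    MonotoneOn (deriv τ^[n]) (cell τ a b n w) := by
  intro x hx y hy hxy
  rw [deriv_iterate_cell h hx, deriv_iterate_cell h hy]
  refine Finset.prod_le_prod (fun k _ => (deriv_pos h (hx.2 k)).le) fun k _ => ?_
  exact h.monotoneOn_deriv _ (hx.2 k) (hy.2 k)
    ((strictMonoOn_iterate_cell h k.2.le).monotoneOn hx hy hxy)

theorem ENNReal.tsum_pi_fin_prod (p : ℕ → ℝ≥0∞) (n : ℕ) :
    ∑' w : Fin n → ℕ, ∏ k, p (w k) = (∑' i, p i) ^ n := by
  induction n with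
  | zero => simp
  | succ n ih =>
    rw [← (Fin.consEquiv fun _ : Fin (n + 1) => ℕ).tsum_eq, ENNReal.tsum_prod', pow_succ', ← ih,
      ← ENNReal.tsum_mul_right]
    refine tsum_congr fun i => ?_
    rw [← ENNReal.tsum_mul_left]
    refine tsum_congr fun v => ?_
    rw [Fin.prod_univ_succ]
    simp [Fin.consEquiv]

/-- Summable and uniformly small bounds for the inverse slopes of the branches of an iterate. -/
theorem exists_iterate_slope_bounds (h : IsPiecewiseConvex τ a b) {ε : ℝ} (hε : 0 < ε) :
    ∃ n : ℕ, 0 < n ∧ ∃ q : (Fin n → ℕ) → ℝ, (∀ w, 0 ≤ q w ∧ q w ≤ ε) ∧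
      ∑' w, ENNReal.ofReal (q w) ≠ ∞ ∧
      ∀ w, ∀ x ∈ cell τ a b n w, (deriv τ^[n] x)⁻¹ ≤ q w := by
  obtain ⟨d, hd, hd0, hds, -⟩ := h.slopes
  obtain ⟨n, hn, H⟩ := h.exists_expanding ε⁻¹
  have hp : ∀ w : Fin n → ℕ, 0 ≤ ∏ k, 1 / d (w k) := fun w =>
    Finset.prod_nonneg fun k _ => (one_div_pos.2 (hd0 _)).le
  refine ⟨n, hn, fun w => min ε (∏ k, 1 / d (w k)), fun w => ⟨le_min hε.le (hp w), min_le_left _ _⟩,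
    ?_, fun w x hx => le_min ?_ ?_⟩
  · refine ne_top_of_le_ne_top (b := ∑' w : Fin n → ℕ, ∏ k, ENNReal.ofReal (1 / d (w k))) ?_
      (ENNReal.tsum_le_tsum fun w => ?_)
    · rw [ENNReal.tsum_pi_fin_prod fun i => ENNReal.ofReal (1 / d i)]
      exact ENNReal.pow_ne_top hds.tsum_ofReal_ne_top
    · rw [← ENNReal.ofReal_prod_of_nonneg fun k _ => (one_div_pos.2 (hd0 _)).le]
      exact ENNReal.ofReal_le_ofReal (min_le_right _ _)
  · rw [(h.hasDerivAt_iterate (exists_mem_of_mem_cell hx)).deriv]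
    exact inv_le_of_inv_le₀ hε (H x (exists_mem_of_mem_cell hx))
  · rw [deriv_iterate_cell h hx, ← Finset.prod_inv_distrib]
    refine Finset.prod_le_prod (fun k _ => (inv_pos.2 (deriv_pos h (hx.2 k))).le) fun k _ => ?_
    rw [one_div]
    exact inv_anti₀ (hd0 _) (h.le_deriv (hd _) (hx.2 k))

end Cell

section Branch

variable {𝕜 : Type*} [RCLike 𝕜] {σ : ℝ → ℝ} {J : Set ℝ} {f : ℝ → 𝕜} {q : ℝ} {M : ℝ≥0∞}

/-- The contribution of one branch to the Frobenius–Perron operator. -/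
noncomputable def branchTransfer (σ : ℝ → ℝ) (J : Set ℝ) (f : ℝ → 𝕜) : ℝ → 𝕜 :=
  (σ '' J).indicator fun z => f (Function.invFunOn σ J z) /
    ((deriv σ (Function.invFunOn σ J z) : ℝ) : 𝕜)

theorem frobeniusPerron_eq_tsum {ι : Type*} (σ : ℝ → ℝ) (J : ι → Set ℝ) (f : ℝ → 𝕜) :
    frobeniusPerron σ J f = fun x => ∑' i, branchTransfer σ (J i) f x :=
  rfl

theorem branchTransfer_apply (hσ : InjOn σ J) {x : ℝ} (hx : x ∈ J) :
    branchTransfer σ J f (σ x) = (deriv σ x)⁻¹ • f x := by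
  rw [branchTransfer, indicator_of_mem (mem_image_of_mem σ hx),
    show Function.invFunOn σ J (σ x) = x from hσ.leftInvOn_invFunOn hx,
    RCLike.real_smul_eq_coe_mul, RCLike.ofReal_inv, div_eq_inv_mul]

theorem branchTransfer_of_notMem {z : ℝ} (hz : z ∉ σ '' J) : branchTransfer σ J f z = 0 :=
  indicator_of_notMem hz _

theorem enorm_branchTransfer_le (hσ : InjOn σ J) (h0 : ∀ x ∈ J, 0 < deriv σ x)
    (hq : ∀ x ∈ J, (deriv σ x)⁻¹ ≤ q) (hM : ∀ x ∈ J, ‖f x‖ₑ ≤ M) (z : ℝ) :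
    ‖branchTransfer σ J f z‖ₑ ≤ ENNReal.ofReal q * M := by
  by_cases hz : z ∈ σ '' J
  · obtain ⟨x, hx, rfl⟩ := hz
    rw [branchTransfer_apply hσ hx, enorm_smul, Real.enorm_of_nonneg (inv_pos.2 (h0 x hx)).le]
    gcongr
    · exact hq x hx
    · exact hM x hx
  · rw [branchTransfer_of_notMem hz]
    simp

theorem eVariationOn_branchTransfer_le (hσ : StrictMonoOn σ J) (hJ : (σ '' J).OrdConnected)
    (h0 : ∀ x ∈ J, 0 < deriv σ x) (hmono : MonotoneOn (deriv σ) J)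
    (hq : ∀ x ∈ J, (deriv σ x)⁻¹ ≤ q) (hM : ∀ x ∈ J, ‖f x‖ₑ ≤ M) {t : Set ℝ} (ht : σ '' J ⊆ t) :
    eVariationOn (branchTransfer σ J f) t ≤ ENNReal.ofReal q * (eVariationOn f J + 3 * M) := by
  have h1 : eVariationOn (branchTransfer σ J f) (σ '' J) ≤
      ENNReal.ofReal q * eVariationOn f J + M * ENNReal.ofReal q := by
    rw [← eVariationOn.comp_eq_of_monotoneOn _ σ hσ.monotoneOn,
      eVariationOn.eq_of_eqOn (f := branchTransfer σ J f ∘ σ) (f' := (fun x => (deriv σ x)⁻¹) • f)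
        fun x hx => branchTransfer_apply hσ.injOn hx]
    refine (eVariationOn_smul_le (C := ENNReal.ofReal q) (fun x hx => ?_) hM).trans ?_
    · rw [Real.enorm_of_nonneg (inv_pos.2 (h0 x hx)).le]
      exact ENNReal.ofReal_le_ofReal (hq x hx)
    · gcongr
      refine AntitoneOn.eVariationOn_le_of_mem_Icc (fun x hx y hy hxy => ?_)
        fun x hx => ⟨(inv_pos.2 (h0 x hx)).le, hq x hx⟩
      exact inv_anti₀ (h0 x hx) (hmono hx hy hxy)
  calc _ ≤ eVariationOn (branchTransfer σ J f) (σ '' J) + 2 * (ENNReal.ofReal q * M) :=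
        eVariationOn_le_of_eq_zero_off _ hJ ht (fun x hx => branchTransfer_of_notMem hx)
          fun x _ => enorm_branchTransfer_le hσ.injOn h0 hq hM x
    _ ≤ (ENNReal.ofReal q * eVariationOn f J + M * ENNReal.ofReal q) +
        2 * (ENNReal.ofReal q * M) := by gcongr
    _ = _ := by ring

end Branch

section Transfer

variable {𝕜 : Type*} [RCLike 𝕜] {τ : ℝ → ℝ} {a b : ℕ → ℝ} {n : ℕ}

theorem cell_subset_unitI (w : Fin n → ℕ) : cell τ a b n w ⊆ unitI := fun _ hx => hx.1

theorem differentiableAt_iterate_cell (h : IsPiecewiseConvex τ a b) {w : Fin n → ℕ} {x : ℝ}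
    (hx : x ∈ cell τ a b n w) : DifferentiableAt ℝ τ^[n] x :=
  (h.hasDerivAt_iterate (exists_mem_of_mem_cell hx)).differentiableAt

/-- The Frobenius–Perron operator is well defined on classes of functions. -/
theorem frobeniusPerron_congr_ae (h : IsPiecewiseConvex τ a b) {f g : ℝ → 𝕜}
    (hfg : f =ᵐ[lebI] g) :
    frobeniusPerron τ^[n] (cell τ a b n) f =ᵐ[lebI] frobeniusPerron τ^[n] (cell τ a b n) g := by
  have h0 : volume ({x | f x ≠ g x} ∩ unitI) = 0 := by
    rw [Filter.EventuallyEq, ae_iff, Measure.restrict_apply' measurableSet_Icc] at hfg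
    exact hfg
  have h1 : volume (⋃ w : Fin n → ℕ, τ^[n] '' ({x | f x ≠ g x} ∩ cell τ a b n w)) = 0 := by
    refine measure_iUnion_null fun w => ?_
    refine addHaar_image_eq_zero_of_differentiableOn_of_addHaar_eq_zero volume
      (fun x hx => (differentiableAt_iterate_cell h hx.2).differentiableWithinAt) ?_
    exact measure_mono_null (inter_subset_inter_right _ (cell_subset_unitI w)) h0
  refine ae_restrict_of_ae ((measure_eq_zero_iff_ae_notMem.1 h1).mono fun z hz => ?_)
  rw [frobeniusPerron_eq_tsum, frobeniusPerron_eq_tsum]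
  refine tsum_congr fun w => ?_
  by_cases hzw : z ∈ τ^[n] '' cell τ a b n w
  · obtain ⟨x, hx, rfl⟩ := hzw
    have hinj := (strictMonoOn_iterate_cell (w := w) h le_rfl).injOn
    have hfx : f x = g x := by
      by_contra hne
      exact hz (mem_iUnion.2 ⟨w, x, ⟨hne, hx⟩, rfl⟩)
    rw [branchTransfer_apply hinj hx, branchTransfer_apply hinj hx, hfx]
  · rw [branchTransfer_of_notMem hzw, branchTransfer_of_notMem hzw]

/-- Branchwise bounds for the image of a function under the Frobenius–Perron operator. -/
theorem frobeniusPerron_le_tsum (h : IsPiecewiseConvex τ a b) {q : (Fin n → ℕ) → ℝ}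
    (hqs : ∑' w, ENNReal.ofReal (q w) ≠ ∞)
    (hqd : ∀ w, ∀ x ∈ cell τ a b n w, (deriv τ^[n] x)⁻¹ ≤ q w) {g : ℝ → 𝕜} {S : ℝ≥0∞}
    (hS : S ≠ ∞) (hgS : ∀ x ∈ unitI, ‖g x‖ₑ ≤ S) {A M : (Fin n → ℕ) → ℝ≥0∞}
    (hA : ∀ w, eVariationOn g (cell τ a b n w) ≤ A w)
    (hM : ∀ w, ∀ x ∈ cell τ a b n w, ‖g x‖ₑ ≤ M w) :
    eLpNorm (frobeniusPerron τ^[n] (cell τ a b n) g) 1 lebI +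
        eVariationOn (frobeniusPerron τ^[n] (cell τ a b n) g) unitI ≤
      ∑' w, ENNReal.ofReal (q w) * (A w + 4 * M w) := by
  have hσ : ∀ w, StrictMonoOn τ^[n] (cell τ a b n w) := fun w => strictMonoOn_iterate_cell h le_rfl
  have himg : ∀ w, (τ^[n] '' cell τ a b n w).OrdConnected := fun w => by
    refine IsPreconnected.ordConnected (IsPreconnected.image ?_ _ fun x hx =>
      (differentiableAt_iterate_cell h hx).continuousAt.continuousWithinAt)
    exact (ordConnected_cell h).isPreconnected
  have hpos : ∀ w, ∀ x ∈ cell τ a b n w, 0 < deriv τ^[n] x := fun w x hx =>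
    deriv_iterate_cell_pos h hx
  have hsum : ∀ z ∈ unitI, Summable fun w => branchTransfer τ^[n] (cell τ a b n w) g z :=
    fun z _ => by
      refine Summable.of_enorm (ne_top_of_le_ne_top (b := ∑' w, ENNReal.ofReal (q w) * S) ?_
        (ENNReal.tsum_le_tsum fun w => enorm_branchTransfer_le (hσ w).injOn (hpos w) (hqd w)
          (fun x hx => hgS x hx.1) z))
      rw [ENNReal.tsum_mul_right]
      exact ENNReal.mul_ne_top hqs hS
  have hvar : eVariationOn (frobeniusPerron τ^[n] (cell τ a b n) g) unitI ≤
      ∑' w, ENNReal.ofReal (q w) * (A w + 3 * M w) := by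
    rw [frobeniusPerron_eq_tsum]
    refine (eVariationOn_tsum_le _ hsum).trans (ENNReal.tsum_le_tsum fun w => ?_)
    refine (eVariationOn_branchTransfer_le (hσ w) (himg w) (hpos w)
      (monotoneOn_deriv_iterate_cell h) (hqd w) (hM w) ?_).trans (by gcongr; exact hA w)
    exact image_subset_iff.2 fun x hx => h.mapsTo.iterate n hx.1
  have hnorm : eLpNorm (frobeniusPerron τ^[n] (cell τ a b n) g) 1 lebI ≤
      ∑' w, ENNReal.ofReal (q w) * M w := by
    rw [eLpNorm_one_eq_lintegral_enorm, frobeniusPerron_eq_tsum]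
    calc _ ≤ ∫⁻ _ in unitI, ∑' w, ENNReal.ofReal (q w) * M w := lintegral_mono fun z =>
          enorm_tsum_le_tsum_enorm.trans (ENNReal.tsum_le_tsum fun w =>
            enorm_branchTransfer_le (hσ w).injOn (hpos w) (hqd w) (hM w) z)
      _ = _ := by rw [setLIntegral_const, Real.volume_Icc]; simp
  refine (add_le_add hnorm hvar).trans_eq ?_
  rw [← ENNReal.tsum_add]
  exact tsum_congr fun w => by ring

/-- Separating finitely many terms of a sum from its tail. -/
theorem tsum_mul_le_of_finset {ι : Type*} (F : Finset ι) {Q v κ A M : ι → ℝ≥0∞} {V N η : ℝ≥0∞}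
    (hQ : ∀ i, Q i ≤ η) (hF : ∑' i : {i // i ∉ F}, Q i ≤ η) (hv : ∑ i ∈ F, v i ≤ V)
    (hAF : ∀ i ∈ F, A i = v i) (hMF : ∀ i ∈ F, M i = v i + κ i * N)
    (hA : ∀ i ∉ F, A i = V) (hM : ∀ i ∉ F, M i = V + N) :
    ∑' i, Q i * (A i + 4 * M i) ≤
      (5 * η + 5 * η) * V + (4 * ∑ i ∈ F, Q i * κ i + 4 * η) * N := by
  have hfin : ∑ i ∈ F, Q i * (A i + 4 * M i) ≤ 5 * η * V + 4 * (∑ i ∈ F, Q i * κ i) * N := by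
    calc _ = ∑ i ∈ F, (Q i * (5 * v i) + 4 * (Q i * κ i * N)) :=
          Finset.sum_congr rfl fun i hi => by
            rw [hAF i hi, hMF i hi]
            ring
      _ ≤ ∑ i ∈ F, (η * (5 * v i) + 4 * (Q i * κ i * N)) :=
          Finset.sum_le_sum fun i _ => by
            gcongr
            exact hQ i
      _ = 5 * η * ∑ i ∈ F, v i + 4 * (∑ i ∈ F, Q i * κ i) * N := by
          rw [Finset.sum_add_distrib, ← Finset.mul_sum, ← Finset.mul_sum, ← Finset.mul_sum,
            ← Finset.sum_mul]
          ring
      _ ≤ _ := by gcongr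
  have htail : ∑' i : {i // i ∉ F}, Q i * (A i + 4 * M i) ≤ η * (5 * V + 4 * N) := by
    calc _ = ∑' i : {i // i ∉ F}, Q i * (5 * V + 4 * N) := tsum_congr fun i => by
          rw [hA i i.2, hM i i.2]
          ring
      _ ≤ _ := by
          rw [ENNReal.tsum_mul_right]
          gcongr
  calc _ = ∑ i ∈ F, Q i * (A i + 4 * M i) + ∑' i : {i // i ∉ F}, Q i * (A i + 4 * M i) :=
        (ENNReal.sum_add_tsum_compl F fun i => Q i * (A i + 4 * M i)).symm
    _ ≤ (5 * η * V + 4 * (∑ i ∈ F, Q i * κ i) * N) + η * (5 * V + 4 * N) := add_le_add hfin htail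
    _ = _ := by ring

/-- The Lasota–Yorke inequality for a function, rather than a class of functions. -/
theorem exists_lasotaYorke (𝕜 : Type*) [RCLike 𝕜] (h : IsPiecewiseConvex τ a b) :
    ∃ n : ℕ, 0 < n ∧ ∃ C : ℝ, 0 < C ∧ ∀ g : ℝ → 𝕜,
      eVariationOn g unitI ≠ ∞ → eLpNorm g 1 lebI ≠ ∞ →
      eLpNorm (frobeniusPerron τ^[n] (cell τ a b n) g) 1 lebI +
        eVariationOn (frobeniusPerron τ^[n] (cell τ a b n) g) unitI ≤
      (1 / 2) * eVariationOn g unitI + ENNReal.ofReal C * eLpNorm g 1 lebI := by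
  classical
  obtain ⟨n, hn, q, hq, hqs, hqd⟩ := exists_iterate_slope_bounds h (ε := 1 / 20) (by norm_num)
  obtain ⟨η, hη⟩ : ∃ η, η = ENNReal.ofReal (1 / 20) := ⟨_, rfl⟩
  have hη0 : 0 < η := by rw [hη]; positivity
  have hη1 : η ≠ ∞ := by rw [hη]; exact ENNReal.ofReal_ne_top
  have h10 : 5 * η + 5 * η = 1 / 2 := by
    have h5 : (5 : ℝ≥0∞) = ENNReal.ofReal 5 := by simp
    have h2 : (1 / 2 : ℝ≥0∞) = ENNReal.ofReal (1 / 2) := by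
      rw [one_div, one_div, ENNReal.ofReal_inv_of_pos two_pos, ENNReal.ofReal_ofNat]
    rw [hη, h5, h2, ← ENNReal.ofReal_mul (by norm_num),
      ← ENNReal.ofReal_add (by norm_num) (by norm_num)]
    norm_num
  obtain ⟨F, hF⟩ : ∃ F : Finset (Fin n → ℕ), ∑' w : {w // w ∉ F}, ENNReal.ofReal (q w) ≤ η :=
    ((tendsto_order.1 (ENNReal.tendsto_tsum_compl_atTop_zero hqs)).2 η hη0).exists.imp
      fun _ hF => hF.le
  have hopen : ∀ w, IsOpen (cell τ a b n w) := fun w => isOpen_cell h hn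
  obtain ⟨κ, hκ, hκJ⟩ : ∃ κ : (Fin n → ℕ) → ℝ≥0∞, (∀ w, κ w ≠ ∞) ∧
      ∀ w, (cell τ a b n w).Nonempty → κ w = (volume (cell τ a b n w))⁻¹ := by
    refine ⟨fun w => if (cell τ a b n w).Nonempty then (volume (cell τ a b n w))⁻¹ else 0,
      fun w => ?_, fun w hw => if_pos hw⟩
    by_cases hw : (cell τ a b n w).Nonempty
    · simp only [if_pos hw]
      exact ENNReal.inv_ne_top.2 ((hopen w).measure_pos volume hw).ne'
    · simp [hw]
  have hB : 4 * ∑ w ∈ F, ENNReal.ofReal (q w) * κ w + 4 * η ≠ ∞ := by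
    refine ENNReal.add_ne_top.2 ⟨ENNReal.mul_ne_top (by simp) ?_, ENNReal.mul_ne_top (by simp) hη1⟩
    exact ENNReal.sum_ne_top.2 fun w _ => ENNReal.mul_ne_top ENNReal.ofReal_ne_top (hκ w)
  refine ⟨n, hn, (4 * ∑ w ∈ F, ENNReal.ofReal (q w) * κ w + 4 * η).toReal + 1, by positivity,
    fun g hV hN => ?_⟩
  have hvol : volume unitI = 1 := by simp [unitI]
  have hI : ∀ x ∈ unitI, ‖g x‖ₑ ≤ eVariationOn g unitI + eLpNorm g 1 lebI := fun x hx => by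
    have := enorm_le_eVariationOn_add g measurableSet_Icc (Subset.refl unitI)
      (by rw [hvol]; simp) (by rw [hvol]; simp) hx
    rwa [hvol, inv_one, one_mul] at this
  refine (frobeniusPerron_le_tsum h hqs hqd (ENNReal.add_ne_top.2 ⟨hV, hN⟩) hI
    (A := fun w => if w ∈ F then eVariationOn g (cell τ a b n w) else eVariationOn g unitI)
    (M := fun w => if w ∈ F then eVariationOn g (cell τ a b n w) + κ w * eLpNorm g 1 lebI
      else eVariationOn g unitI + eLpNorm g 1 lebI) (fun w => ?_) fun w x hx => ?_).trans ?_
  · by_cases hw : w ∈ F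
    · simp only [if_pos hw, le_refl]
    · simp only [if_neg hw]
      exact eVariationOn.mono g (cell_subset_unitI w)
  · by_cases hw : w ∈ F
    · have hne : (cell τ a b n w).Nonempty := ⟨x, hx⟩
      simp only [if_pos hw, hκJ w hne]
      refine enorm_le_eVariationOn_add g (hopen w).measurableSet (cell_subset_unitI w)
        ((hopen w).measure_pos volume hne).ne' ?_ hx
      exact ne_top_of_le_ne_top (by rw [hvol]; simp) (measure_mono (cell_subset_unitI w))
    · simp only [if_neg hw]
      exact hI x hx.1
  · refine (tsum_mul_le_of_finset F (v := fun w => eVariationOn g (cell τ a b n w)) (κ := κ)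
      (V := eVariationOn g unitI) (N := eLpNorm g 1 lebI)
      (fun w => hη ▸ ENNReal.ofReal_le_ofReal (hq w).2) hF
      (sum_eVariationOn_le g (fun w => ordConnected_cell h) (pairwise_disjoint_cell h n)
        cell_subset_unitI F) (fun w hw => if_pos hw) (fun w hw => if_pos hw)
      (fun w hw => if_neg hw) (fun w hw => if_neg hw)).trans ?_
    rw [h10, ENNReal.ofReal_add ENNReal.toReal_nonneg zero_le_one, ENNReal.ofReal_toReal hB]
    exact add_le_add le_rfl (mul_le_mul' le_self_add le_rfl)

end Transfer

theorem proposition2p2p5 {𝕜 : Type*} [RCLike 𝕜] (τ : ℝ → ℝ) (a b : ℕ → ℝ)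
    (hτ : IsPiecewiseConvex τ a b) :
    ∃ n : ℕ, 0 < n ∧ ∃ C : ℝ, 0 < C ∧ ∀ f : ℝ → 𝕜, MemBV f →
      MemBV (frobeniusPerron (τ^[n]) (cell τ a b n) f) ∧
      bvNorm (frobeniusPerron (τ^[n]) (cell τ a b n) f) ≤
        (1 / 2) * bvNorm f + ENNReal.ofReal C * eLpNorm f 1 lebI := by
  obtain ⟨n, hn, C, hC, H⟩ := exists_lasotaYorke 𝕜 hτ
  refine ⟨n, hn, C, hC, fun f hf => ?_⟩
  set P := frobeniusPerron (𝕜 := 𝕜) (τ^[n]) (cell τ a b n)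
  have hN : eLpNorm f 1 lebI ≠ ∞ := hf.1.2.ne
  have hV : varI f ≠ ∞ := ne_top_of_le_ne_top hf.2.ne le_add_self
  have hstep : ∀ g : ℝ → 𝕜, g =ᵐ[lebI] f →
      bvNorm (P f) ≤ (1 / 2) * eVariationOn g unitI + ENNReal.ofReal C * eLpNorm f 1 lebI := by
    intro g hg
    by_cases hgV : eVariationOn g unitI = ∞
    · rw [hgV, ENNReal.mul_top (by simp), top_add]
      exact le_top
    have hP : P g =ᵐ[lebI] P f := frobeniusPerron_congr_ae hτ hg
    have hg1 := eLpNorm_congr_ae (p := 1) hg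
    have := H g hgV (hg1 ▸ hN)
    rw [eLpNorm_congr_ae hP, hg1] at this
    refine le_trans ?_ this
    rw [bvNorm]
    gcongr
    exact iInf_le (fun g : {g : ℝ → 𝕜 // g =ᵐ[lebI] P f} => eVariationOn (g : ℝ → 𝕜) unitI)
      ⟨P g, hP⟩
  have hineq : bvNorm (P f) ≤ (1 / 2) * varI f + ENNReal.ofReal C * eLpNorm f 1 lebI := by
    rw [varI, ENNReal.mul_iInf_of_ne (by simp) (by simp), ENNReal.iInf_add]
    exact le_iInf fun g => hstep g g.2
  have hfin : bvNorm (P f) < ∞ := hineq.trans_lt <| ENNReal.add_lt_top.2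
    ⟨ENNReal.mul_lt_top (by simp) hV.lt_top, ENNReal.mul_lt_top (by simp) hN.lt_top⟩
  have hmeas : AEStronglyMeasurable (P f) lebI := by
    have hvar : varI (P f) < ∞ := lt_of_le_of_lt le_add_self hfin
    obtain ⟨g, hg⟩ := iInf_lt_iff.1 hvar
    have hgb : BoundedVariationOn (g : ℝ → 𝕜) unitI := hg.ne
    exact (hgb.aestronglyMeasurable_restrict measurableSet_Icc).congr g.2
  refine ⟨⟨⟨hmeas, lt_of_le_of_lt le_self_add hfin⟩, hfin⟩, hineq.trans ?_⟩
  gcongr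
  exact le_add_self
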